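/- Let $K$ be an ordered field, and let $L^d_{\mathrm{ovs}}=\{+,-,0,1,<\}\cup\{\ell_\lambda:\lambda\in K\}\cup\{U\}$, where $\ell_\lambda$ is a unary function symbol for multiplication by $\lambda$ and $U$ is a unary relation symbol. Let $T^d_{\mathrm{ovs}}$ be the $L^d_{\mathrm{ovs}}$-theory of dense pairs of ordered vector spaces over $K$: its models are the structures $(V,W)$ where $V$ is a (linearly) ordered vector space over $K$, $U$ is interpreted as a proper $K$-linear subspace $W$ of $V$ that is dense in $V$ (for all $a<b$ in $V$ there is $w\in W$ with $a<w<b$), and $1$ is interpreted as a positive element of $W$. For a structure $\mathcal M$ in a language $L$, a finite set $\Delta(x;y)$ of partitioned $L$-formulas with object variables $x=(x_1,\dots,x_m)$ and parameter variables $y=(y_1,\dots,y_n)$, and $B\subseteq M^n$, a $\Delta$-type over $B$ is a maximal consistent (i.e. realized in some elementary extension of $\mathcal M$) set of formulas of the form $\phi(x;b)$ or $\neg\phi(x;b)$ with $\phi\in\Delta$ and $b\in B$. The set $\Delta(x;y)$ has uniform definability of types over finite sets (UDTFS) with $d$ parameters in $\mathcal M$ if there are finitely many families $(\phi^1(y;y_1,\dots,y_d))_{\phi\in\Delta},\dots,(\phi^r(y;y_1,\dots,y_d))_{\phi\in\Delta}$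 of $L$-formulas, where each $y_j$ is an $n$-tuple of variables, such that for every finite nonempty $B\subseteq M^n$ and every $\Delta$-type $p$ over $B$ there are $i\in\{1,\dots,r\}$ and $b_1,\dots,b_d\in B$ such that for all $b\in B$ and $\phi\in\Delta$: $\phi(x;b)\in p$ if and only if $\mathcal M\models\phi^i(b;b_1,\dots,b_d)$. The structure $\mathcal M$ has the VC $d$ property if every finite set $\Delta(x;y)$ of partitioned $L$-formulas with a single object variable $x$ (and any number $n\ge 0$ of parameter variables) has UDTFS with $d$ parameters in $\mathcal M$. **Theorem.** The theory of dense pairs of ordered vector spaces over $K$ has the VC $2$ property: every model $(V,W)$ of $T^d_{\mathrm{ovs}}$ has the VC $2$ property. -/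

import Mathlib

open FirstOrder

universe u v w

namespace FirstOrder.Language

/-! ### Types over finite sets and their uniform definability -/

section UDTFS

variable {L : Language.{u, v}} {M : Type w} [L.Structure M]

/-- The formula `φ(x; b)` with parameters from `M`, obtained from the partitioned formula
`φ(x; y)` by substituting (the constants naming) `b` for the parameter variables `y`. -/
noncomputable def paramInstance {α β : Type} (φ : L.Formula (α ⊕ β)) (b : β → M) :
    L[[M]].Formula α :=
  ((L.lhomWithConstants M).onFormula φ).subst
    (Sum.elim Term.var fun j => (L.con (b j)).term)

/-- The set of formulas of the form `φ(x; b)` or `¬ φ(x; b)` with `φ ∈ Δ` and `b ∈ B`. -/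
def deltaInstances {α β : Type} (Δ : Finset (L.Formula (α ⊕ β))) (B : Set (β → M)) :
    Set (L[[M]].Formula α) :=
  {ψ | ∃ φ ∈ Δ, ∃ b ∈ B, ψ = paramInstance φ b ∨ ψ = (paramInstance φ b).not}

variable (M) in
/-- A set of formulas with parameters from `M` is consistent if it is realized in some model of
the elementary diagram of `M`, that is, in some elementary extension of `M`. -/
def IsConsistent {α : Type} (p : Set (L[[M]].Formula α)) : Prop :=
  ∃ (N : Theory.ModelType.{max u w, v, max u v w} (L.elementaryDiagram M)) (a : α → N), ∀ ψ ∈ p, ψ.Realize a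

/-- `p` is a (complete) `Δ`-type over `B`: a maximal consistent set of formulas of the form
`φ(x; b)` or `¬ φ(x; b)` with `φ ∈ Δ` and `b ∈ B`. -/
def IsDeltaType {α β : Type} (Δ : Finset (L.Formula (α ⊕ β))) (B : Set (β → M))
    (p : Set (L[[M]].Formula α)) : Prop :=
  Maximal (fun q => q ⊆ deltaInstances Δ B ∧ IsConsistent M q) p

variable (M) in
/-- The finite set `Δ(x; y)` of partitioned formulas, where `x = (x₁, …, xₘ)` and
`y = (y₁, …, yₙ)`, has uniform definability of types over finite sets with `d` parameters
in `M`. The formula `δ i φ` is `φⁱ(y; y₁, …, y_d)`; its `d` parameter tuples, each of length `n`,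
are indexed by `Fin d × Fin n`. -/
def HasUDTFS (d : ℕ) {m n : ℕ} (Δ : Finset (L.Formula (Fin m ⊕ Fin n))) : Prop :=
  ∃ (r : ℕ) (δ : Fin r → Δ → L.Formula (Fin n ⊕ (Fin d × Fin n))),
    ∀ B : Set (Fin n → M), B.Finite → B.Nonempty →
      ∀ p : Set (L[[M]].Formula (Fin m)), IsDeltaType Δ B p →
        ∃ (i : Fin r) (c : Fin d → Fin n → M), (∀ k, c k ∈ B) ∧
          ∀ (φ : Δ), ∀ b ∈ B,
            (paramInstance (φ : L.Formula (Fin m ⊕ Fin n)) b ∈ p ↔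
              (δ i φ).Realize (Sum.elim b fun kj : Fin d × Fin n => c kj.1 kj.2))

variable (L M) in
/-- The VC `d` property of the structure `M`: every finite set of partitioned formulas with a
single object variable has uniform definability of types over finite sets with `d` parameters. -/
def HasVCProperty (d : ℕ) : Prop :=
  ∀ (n : ℕ) (Δ : Finset (L.Formula (Fin 1 ⊕ Fin n))), HasUDTFS M d Δ

end UDTFS

/-! ### Dense pairs of ordered vector spaces -/

/-- The function symbols `+`, `-`, `0`, `1` and `ℓ_c` for `c ∈ K`. -/
inductive ovsFunc (K : Type u) : ℕ → Type u
  | add : ovsFunc K 2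
  | neg : ovsFunc K 1
  | zero : ovsFunc K 0
  | one : ovsFunc K 0
  | smul (c : K) : ovsFunc K 1

/-- The relation symbols `<` and `U`. -/
inductive ovsRel : ℕ → Type
  | lt : ovsRel 2
  | U : ovsRel 1

/-- The language of pairs of ordered vector spaces over `K`:
`{+, -, 0, 1, <} ∪ {ℓ_c : c ∈ K} ∪ {U}`. -/
def ovsPair (K : Type u) : Language.{u, 0} := ⟨ovsFunc K, ovsRel⟩

namespace ovsPair

section Symbols

variable {K : Type u} {α : Type} {n : ℕ}

/-- The symbol `+` as a function symbol of `ovsPair K`. -/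
abbrev addFunc : (ovsPair K).Functions 2 := ovsFunc.add

/-- The symbol `-` as a function symbol of `ovsPair K`. -/
abbrev negFunc : (ovsPair K).Functions 1 := ovsFunc.neg

/-- The symbol `0` as a constant of `ovsPair K`. -/
abbrev zeroFunc : (ovsPair K).Constants := ovsFunc.zero

/-- The symbol `1` as a constant of `ovsPair K`. -/
abbrev oneFunc : (ovsPair K).Constants := ovsFunc.one

/-- The symbol `ℓ_c` as a function symbol of `ovsPair K`. -/
abbrev smulFunc (c : K) : (ovsPair K).Functions 1 := ovsFunc.smul c

/-- The symbol `<` as a relation symbol of `ovsPair K`. -/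
abbrev ltRel : (ovsPair K).Relations 2 := ovsRel.lt

/-- The symbol `U` as a relation symbol of `ovsPair K`. -/
abbrev uRel : (ovsPair K).Relations 1 := ovsRel.U

/-- The term `s + t`. -/
def tAdd (s t : (ovsPair K).Term α) : (ovsPair K).Term α :=
  addFunc.apply₂ s t

/-- The term `- t`. -/
def tNeg (t : (ovsPair K).Term α) : (ovsPair K).Term α :=
  negFunc.apply₁ t

/-- The term `0`. -/
def tZero : (ovsPair K).Term α := zeroFunc.term

/-- The term `1`. -/
def tOne : (ovsPair K).Term α := oneFunc.term

/-- The term `ℓ_c(t)`. -/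
def tSmul (c : K) (t : (ovsPair K).Term α) : (ovsPair K).Term α :=
  (smulFunc c).apply₁ t

/-- The formula `s < t`. -/
def fLt (s t : (ovsPair K).Term (α ⊕ Fin n)) : (ovsPair K).BoundedFormula α n :=
  ltRel.boundedFormula₂ s t

/-- The formula `U(t)`. -/
def fU (t : (ovsPair K).Term (α ⊕ Fin n)) : (ovsPair K).BoundedFormula α n :=
  uRel.boundedFormula₁ t

end Symbols

section Theory

variable (K : Type u) [Field K] [LinearOrder K]

/-- Names for the sentences in the theory of dense pairs of ordered vector spaces. -/
inductive Law : Type u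
  -- an abelian group
  | addAssoc
  | addComm
  | addZero
  | addNeg
  -- a `K`-vector space
  | smulAdd (c : K)
  | addSmul (c d : K)
  | mulSmul (c d : K)
  | oneSmul
  -- a linear order, compatible with addition and with multiplication by positive scalars
  | ltIrrefl
  | ltTrans
  | ltTotal
  | addLt
  | smulPos (c : K) (hc : 0 < c)
  -- the distinguished element is positive
  | onePos
  -- `U` is a proper dense subspace that contains the distinguished element
  | zeroMem
  | oneMem
  | addMem
  | smulMem (c : K)
  | dense
  | proper

variable {K}

/-- The sentence with a given name. -/
def Law.toSentence : Law K → (ovsPair K).Sentence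
  | addAssoc => ∀' ∀' ∀' (tAdd (tAdd (&0) (&1)) (&2) =' tAdd (&0) (tAdd (&1) (&2)))
  | addComm => ∀' ∀' (tAdd (&0) (&1) =' tAdd (&1) (&0))
  | addZero => ∀' (tAdd (&0) tZero =' &0)
  | addNeg => ∀' (tAdd (&0) (tNeg (&0)) =' tZero)
  | smulAdd c => ∀' ∀' (tSmul c (tAdd (&0) (&1)) =' tAdd (tSmul c (&0)) (tSmul c (&1)))
  | addSmul c d => ∀' (tSmul (c + d) (&0) =' tAdd (tSmul c (&0)) (tSmul d (&0)))
  | mulSmul c d => ∀' (tSmul (c * d) (&0) =' tSmul c (tSmul d (&0)))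
  | oneSmul => ∀' (tSmul 1 (&0) =' &0)
  | ltIrrefl => ∀' ∼(fLt (&0) (&0))
  | ltTrans => ∀' ∀' ∀' (fLt (&0) (&1) ⟹ fLt (&1) (&2) ⟹ fLt (&0) (&2))
  | ltTotal => ∀' ∀' (fLt (&0) (&1) ⊔ ((&0 =' &1) ⊔ fLt (&1) (&0)))
  | addLt => ∀' ∀' ∀' (fLt (&0) (&1) ⟹ fLt (tAdd (&0) (&2)) (tAdd (&1) (&2)))
  | smulPos c _ => ∀' (fLt tZero (&0) ⟹ fLt tZero (tSmul c (&0)))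
  | onePos => fLt tZero tOne
  | zeroMem => fU tZero
  | oneMem => fU tOne
  | addMem => ∀' ∀' (fU (&0) ⟹ fU (&1) ⟹ fU (tAdd (&0) (&1)))
  | smulMem c => ∀' (fU (&0) ⟹ fU (tSmul c (&0)))
  | dense => ∀' ∀' (fLt (&0) (&1) ⟹ ∃' (fU (&2) ⊓ (fLt (&0) (&2) ⊓ fLt (&2) (&1))))
  | proper => ∃' ∼(fU (&0))

variable (K) in
/-- The theory of dense pairs of ordered vector spaces over the ordered field `K`, with a
distinguished positive element `1` of the subspace. -/
def densePairs : (ovsPair K).Theory := Set.range (Law.toSentence (K := K))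

end Theory

end ovsPair

end FirstOrder.Language

/-!
This module proves that every dense pair `(V, W)` of ordered `K`-vector spaces has the VC 2
property.

Call two elements of `V` *alike* if they have the same sign and either both or neither lie in
`W`. Quantifier elimination is used in a semantic form (`exists_finite_determining_terms`): the
truth of a formula at a tuple depends only on finitely many terms, up to likeness of their values.
The induction step for a quantifier is the back-and-forth lemma `exists_alike_sub`. An element `x`
outside a finite set of values has to be matched with an `x'` in a prescribed gap and either in
a prescribed coset of `W` or outside finitely many cosets. This is possible since every coset of
`W` is dense, and since `V ⧸ W`, being a nonzero vector space over an infinite field, is infinite.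

Consequently there is a finite set `T` of terms in the parameter variables `y` such that the
truth of all `φ(a; b)` depends, for a given `b`, only on how `a - t(b)` compares with `0` and
whether it lies in `W`, for `t ∈ T`. For a finite set `B` of parameters, the first
of these is described for all `b ∈ B` by the largest value `t(b₁) ≤ a` with `t ∈ T`, `b₁ ∈ B`, and
the second by a single value `t'(b₂)` congruent to `a` modulo `W`. Two parameter tuples suffice,
and there are finitely many choices for the terms and for the shape of the cut
(`exists_isDescribed`). The defining formula says that some `x` with this description satisfies
`φ(x; y)`; the truth of `φ(x; b)` is the same for all such `x`.

A `Δ`-type over a finite set is a finite set of formulas, hence realized in the structure itself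
(`IsDeltaType.exists_realize_iff`), so it suffices to consider types of elements of `V`.
-/

namespace FirstOrder.Language

/-! ### Types over finite sets are realized -/

section Types

variable {L : Language.{u, v}} {M : Type w} [L.Structure M]

theorem realize_paramInstance {α β : Type} (φ : L.Formula (α ⊕ β)) (b : β → M) (a : α → M) :
    (paramInstance φ b).Realize a ↔ φ.Realize (Sum.elim a b) := by
  unfold paramInstance Formula.Realize
  rw [BoundedFormula.realize_subst]
  refine (LHom.realize_onFormula (L.lhomWithConstants M) φ).trans ?_
  have : (fun i : α ⊕ β => ((Sum.elim Term.var fun j => (L.con (b j)).term :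
      α ⊕ β → L[[M]].Term α) i).realize a) = Sum.elim a b := by
    funext i
    rcases i with i | j
    · rfl
    · exact Term.realize_constants
  rw [this]
  rfl

omit [L.Structure M] in
theorem finite_deltaInstances {α β : Type} (Δ : Finset (L.Formula (α ⊕ β))) {B : Set (β → M)}
    (hB : B.Finite) : (deltaInstances Δ B).Finite := by
  have h1 := Set.Finite.image2 (fun φ b => paramInstance φ b) Δ.finite_toSet hB
  have h2 := Set.Finite.image2 (fun φ b => (paramInstance φ b).not) Δ.finite_toSet hB
  refine (h1.union h2).subset ?_
  rintro ψ ⟨φ, hφ, b, hb, rfl | rfl⟩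
  · exact Or.inl ⟨φ, hφ, b, hb, rfl⟩
  · exact Or.inr ⟨φ, hφ, b, hb, rfl⟩

/-- A finite consistent set of formulas is realized in the structure itself: its conjunction,
existentially quantified, is a sentence with parameters. -/
theorem IsConsistent.exists_realize {α : Type} [Finite α] {p : Set (L[[M]].Formula α)}
    (hp : p.Finite) (h : IsConsistent M p) : ∃ a : α → M, ∀ ψ ∈ p, ψ.Realize a := by
  obtain ⟨N, a, ha⟩ := h
  have := hp.to_subtype
  let θ : L[[M]].Sentence :=
    Formula.iExs α ((Formula.iInf fun ψ : p => (ψ : L[[M]].Formula α)).relabel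
      (Sum.inr : α → Empty ⊕ α))
  have hN : N ⊨ θ := by
    simpa [θ, Sentence.Realize, Formula.realize_iExs, Formula.realize_relabel,
      Formula.realize_iInf] using ⟨a, ha⟩
  have hM : M ⊨ θ := (realize_iff_of_model_completeTheory M N θ).1 hN
  simpa [θ, Sentence.Realize, Formula.realize_iExs, Formula.realize_relabel,
    Formula.realize_iInf] using hM

/-- A `Δ`-type over a finite set is the type of an element of the structure itself. -/
theorem IsDeltaType.exists_realize_iff {α β : Type} [Finite α] {Δ : Finset (L.Formula (α ⊕ β))}
    {B : Set (β → M)} (hB : B.Finite) {p : Set (L[[M]].Formula α)} (hp : IsDeltaType Δ B p) :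
    ∃ a : α → M, ∀ φ ∈ Δ, ∀ b ∈ B, paramInstance φ b ∈ p ↔ φ.Realize (Sum.elim a b) := by
  obtain ⟨a, ha⟩ := hp.prop.2.exists_realize ((finite_deltaInstances Δ hB).subset hp.prop.1)
  obtain ⟨N, c, hc⟩ := hp.prop.2
  -- by maximality, `p` contains every instance true at a realization in the extension `N`
  have hmem : ∀ ψ ∈ deltaInstances Δ B, ψ.Realize c → ψ ∈ p := by
    intro ψ hψ hψc
    refine hp.le_of_ge (y := insert ψ p) ⟨Set.insert_subset hψ hp.prop.1, N, c, ?_⟩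
      (Set.subset_insert ψ p) (Set.mem_insert ψ p)
    rintro χ (rfl | hχ)
    exacts [hψc, hc χ hχ]
  refine ⟨a, fun φ hφ b hb => ⟨fun h => (realize_paramInstance φ b a).1 (ha _ h), fun h => ?_⟩⟩
  by_contra hn
  have hnot : (paramInstance φ b).not ∈ p :=
    hmem _ ⟨φ, hφ, b, hb, Or.inr rfl⟩ <| by
      rw [Formula.realize_not]
      exact fun h' => hn (hmem _ ⟨φ, hφ, b, hb, Or.inl rfl⟩ h')
  have := ha _ hnot
  rw [Formula.realize_not, realize_paramInstance] at this
  exact this h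

end Types

namespace ovsPair

/-! ### Realization of basic terms and formulas -/

section Realize

variable {K : Type u} {M : Type w} [(ovsPair K).Structure M] {α : Type} {n : ℕ}

@[simp]
theorem realize_tAdd (s t : (ovsPair K).Term α) (v : α → M) :
    (tAdd s t).realize v =
      Structure.funMap (L := ovsPair K) addFunc ![s.realize v, t.realize v] :=
  Term.realize_functions_apply₂

@[simp]
theorem realize_tNeg (t : (ovsPair K).Term α) (v : α → M) :
    (tNeg t).realize v = Structure.funMap (L := ovsPair K) negFunc ![t.realize v] :=
  Term.realize_functions_apply₁

@[simp]
theorem realize_tSmul (c : K) (t : (ovsPair K).Term α) (v : α → M) :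
    (tSmul c t).realize v = Structure.funMap (L := ovsPair K) (smulFunc c) ![t.realize v] :=
  Term.realize_functions_apply₁

@[simp]
theorem realize_tZero (v : α → M) :
    (tZero : (ovsPair K).Term α).realize v = Structure.funMap (L := ovsPair K) zeroFunc ![] :=
  congrArg (Structure.funMap zeroFunc) (Subsingleton.elim _ _)

@[simp]
theorem realize_fLt (s t : (ovsPair K).Term (α ⊕ Fin n)) (v : α → M) (xs : Fin n → M) :
    (fLt s t).Realize v xs ↔ Structure.RelMap (L := ovsPair K) ltRel
      ![s.realize (Sum.elim v xs), t.realize (Sum.elim v xs)] :=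
  BoundedFormula.realize_rel₂

@[simp]
theorem realize_fU (t : (ovsPair K).Term (α ⊕ Fin n)) (v : α → M) (xs : Fin n → M) :
    (fU t).Realize v xs ↔ Structure.RelMap (L := ovsPair K) uRel ![t.realize (Sum.elim v xs)] :=
  BoundedFormula.realize_rel₁

end Realize

/-! ### Ordered vector spaces with a subspace -/

section Alike

variable {K : Type u} [Field K] [LinearOrder K] [IsStrictOrderedRing K]
  {V : Type w} [AddCommGroup V] [LinearOrder V] [IsOrderedAddMonoid V]
  [Module K V] [PosSMulStrictMono K V] (W : Submodule K V)

/-- Two elements are alike if they have the same sign and either both or neither lie in `W`. -/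
def Alike (p q : V) : Prop := (0 < p ↔ 0 < q) ∧ (p < 0 ↔ q < 0) ∧ (p ∈ W ↔ q ∈ W)

variable {W}

omit [LinearOrder K] [IsStrictOrderedRing K] [IsOrderedAddMonoid V] [PosSMulStrictMono K V] in
theorem Alike.symm {p q : V} (h : Alike W p q) : Alike W q p :=
  ⟨h.1.symm, h.2.1.symm, h.2.2.symm⟩

omit [LinearOrder K] [IsStrictOrderedRing K] [IsOrderedAddMonoid V] [PosSMulStrictMono K V] in
theorem Alike.eq_zero_iff {p q : V} (h : Alike W p q) : p = 0 ↔ q = 0 := by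
  have := h.1
  have := h.2.1
  constructor
  · rintro rfl
    exact le_antisymm (by simp_all) (by simp_all)
  · rintro rfl
    exact le_antisymm (by simp_all) (by simp_all)

theorem Alike.smul {p q : V} (h : Alike W p q) (c : K) : Alike W (c • p) (c • q) := by
  rcases lt_trichotomy c 0 with hc | rfl | hc
  · refine ⟨?_, ?_, ?_⟩
    · rw [smul_pos_iff_of_neg_left hc, smul_pos_iff_of_neg_left hc, h.2.1]
    · rw [smul_neg_iff_of_neg_left hc, smul_neg_iff_of_neg_left hc, h.1]
    · rw [W.smul_mem_iff hc.ne, W.smul_mem_iff hc.ne, h.2.2]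
  · simp [Alike]
  · refine ⟨?_, ?_, ?_⟩
    · rw [smul_pos_iff_of_pos_left hc, smul_pos_iff_of_pos_left hc, h.1]
    · rw [smul_neg_iff_of_pos_left hc, smul_neg_iff_of_pos_left hc, h.2.1]
    · rw [W.smul_mem_iff hc.ne', W.smul_mem_iff hc.ne', h.2.2]

omit [LinearOrder V] [IsOrderedAddMonoid V] [PosSMulStrictMono K V] in
/-- `V ⧸ W` is infinite when `W` is proper, so finitely many cosets do not cover `V`. -/
theorem exists_forall_sub_notMem (hW : ∃ z, z ∉ W) {P : Set V} (hP : P.Finite) :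
    ∃ z, ∀ p ∈ P, z - p ∉ W := by
  obtain ⟨z, hz⟩ := hW
  have hinj : Function.Injective fun c : K => W.mkQ (c • z) := by
    intro c d hcd
    by_contra hne
    have : (c - d) • z ∈ W := by
      rw [sub_smul]
      exact (Submodule.Quotient.eq W).1 hcd
    exact hz ((W.smul_mem_iff (sub_ne_zero.2 hne)).1 this)
  obtain ⟨_, ⟨c, rfl⟩, hc⟩ :=
    (Set.infinite_range_of_injective hinj).exists_notMem_finite (hP.image W.mkQ)
  exact ⟨c • z, fun p hp hmem => hc ⟨p, hp, ((Submodule.Quotient.eq W).2 hmem).symm⟩⟩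

omit [LinearOrder K] [IsStrictOrderedRing K] [PosSMulStrictMono K V] in
/-- Every coset of a dense subspace meets every gap between two finite sets. -/
theorem exists_sub_mem_between (hW : ∃ z, z ∉ W)
    (hd : ∀ a b : V, a < b → ∃ w ∈ W, a < w ∧ w < b) (z : V) {A B : Set V} (hA : A.Finite)
    (hB : B.Finite) (hAB : ∀ a ∈ A, ∀ b ∈ B, a < b) :
    ∃ x, x - z ∈ W ∧ (∀ a ∈ A, a < x) ∧ ∀ b ∈ B, x < b := by
  obtain ⟨z₀, hz₀⟩ := hW
  have : Nontrivial V := ⟨z₀, 0, fun h => hz₀ (h ▸ W.zero_mem)⟩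
  have : DenselyOrdered V := ⟨fun a b hab => let ⟨w, _, h⟩ := hd a b hab; ⟨w, h⟩⟩
  -- the gap contains an interval `(m, n)`, and the translate by `-z` of an interval meets `W`
  obtain ⟨m, hAm, hmB⟩ := hA.exists_between' hB hAB
  obtain ⟨n, hmn, hnB⟩ := (Set.finite_singleton m).exists_between' hB
    (fun a ha b hb => ha ▸ hmB b hb)
  obtain ⟨w, hw, h1, h2⟩ := hd (m - z) (n - z) (sub_lt_sub_right (hmn m rfl) z)
  refine ⟨w + z, by simpa using hw, fun a ha => (hAm a ha).trans (sub_lt_iff_lt_add.1 h1),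
    fun b hb => (lt_sub_iff_add_lt.1 h2).trans (hnB b hb)⟩

omit [PosSMulStrictMono K V] in
/-- The back-and-forth step: if two finite families of elements have alike differences, then any
element has a counterpart in the same position relative to the other family. -/
theorem exists_alike_sub (hW : ∃ z, z ∉ W)
    (hd : ∀ a b : V, a < b → ∃ w ∈ W, a < w ∧ w < b) {ι : Type*} {T : Set ι} (hT : T.Finite)
    {p q : ι → V} (h : ∀ i ∈ T, ∀ j ∈ T, Alike W (p i - p j) (q i - q j)) (x : V) :
    ∃ y, ∀ i ∈ T, Alike W (x - p i) (y - q i) := by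
  by_cases hx : ∃ j ∈ T, x = p j
  · obtain ⟨j, hj, rfl⟩ := hx
    exact ⟨q j, fun i hi => h j hj i hi⟩
  have hx : ∀ j ∈ T, x ≠ p j := fun j hj hxj => hx ⟨j, hj, hxj⟩
  -- the coset in which the counterpart of `x` is to be found
  obtain ⟨z, hz⟩ : ∃ z, ∀ i ∈ T, x - p i ∈ W ↔ z - q i ∈ W := by
    by_cases hxW : ∃ j ∈ T, x - p j ∈ W
    · obtain ⟨j, hj, hxj⟩ := hxW
      refine ⟨q j, fun i hi => ?_⟩
      rw [← (h j hj i hi).2.2, ← sub_add_sub_cancel x (p j) (p i)]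
      exact W.add_mem_iff_right hxj
    · obtain ⟨z, hz⟩ := exists_forall_sub_notMem hW (hT.image q)
      exact ⟨z, fun i hi => iff_of_false (fun hxi => hxW ⟨i, hi, hxi⟩)
        (hz _ (Set.mem_image_of_mem q hi))⟩
  obtain ⟨y, hyz, hlo, hhi⟩ := exists_sub_mem_between hW hd z
    (A := q '' {i ∈ T | p i < x}) (B := q '' {i ∈ T | x < p i})
    ((hT.subset (Set.sep_subset _ _)).image q) ((hT.subset (Set.sep_subset _ _)).image q) (by
      rintro _ ⟨i, ⟨hi, hix⟩, rfl⟩ _ ⟨j, ⟨hj, hxj⟩, rfl⟩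
      exact sub_pos.1 ((h j hj i hi).1.1 (sub_pos.2 (hix.trans hxj))))
  refine ⟨y, fun i hi => ?_⟩
  have hmem : x - p i ∈ W ↔ y - q i ∈ W := by
    rw [hz i hi, ← sub_add_sub_cancel y z (q i)]
    exact (W.add_mem_iff_right hyz).symm
  rcases lt_or_gt_of_ne (hx i hi) with hlt | hlt
  · have hy : y < q i := hhi _ ⟨i, ⟨hi, hlt⟩, rfl⟩
    exact ⟨iff_of_false (by simpa using hlt.le) (by simpa using hy.le),
      iff_of_true (sub_neg.2 hlt) (sub_neg.2 hy), hmem⟩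
  · have hy : q i < y := hlo _ ⟨i, ⟨hi, hlt⟩, rfl⟩
    exact ⟨iff_of_true (sub_pos.2 hlt) (sub_pos.2 hy),
      iff_of_false (by simpa using hlt.le) (by simpa using hy.le), hmem⟩

end Alike

/-! ### Dense pairs as structures -/

section DensePair

variable (K : Type u) [Field K] [LinearOrder K]

/-- The symbols of the language of pairs have their standard interpretation in `(V, W)`, where `W`
is a proper dense subspace of the ordered vector space `V`. Nothing is required of the
interpretation of `1`, which only contributes an additive constant to the values of terms. -/
structure IsDensePair {V : Type w} [AddCommGroup V] [LinearOrder V] [Module K V]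
    [(ovsPair K).Structure V] (W : Submodule K V) : Prop where
  funMap_add : ∀ x : Fin 2 → V, Structure.funMap (L := ovsPair K) addFunc x = x 0 + x 1
  funMap_neg : ∀ x : Fin 1 → V, Structure.funMap (L := ovsPair K) negFunc x = -x 0
  funMap_zero : ∀ x : Fin 0 → V, Structure.funMap (L := ovsPair K) zeroFunc x = (0 : V)
  funMap_smul : ∀ (c : K) (x : Fin 1 → V),
    Structure.funMap (L := ovsPair K) (smulFunc c) x = c • x 0
  relMap_lt : ∀ x : Fin 2 → V, Structure.RelMap (L := ovsPair K) ltRel x ↔ x 0 < x 1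
  relMap_U : ∀ x : Fin 1 → V, Structure.RelMap (L := ovsPair K) uRel x ↔ x 0 ∈ W
  exists_notMem : ∃ z, z ∉ W
  dense : ∀ a b : V, a < b → ∃ w ∈ W, a < w ∧ w < b

variable {K}

/-- A model of the theory of dense pairs carries the structure of an ordered vector space with
a proper dense subspace. -/
theorem exists_isDensePair {M : Type w} [(ovsPair K).Structure M] (hM : M ⊨ densePairs K) :
    ∃ (_ : AddCommGroup M) (_ : LinearOrder M) (_ : IsOrderedAddMonoid M) (_ : Module K M)
      (_ : PosSMulStrictMono K M) (W : Submodule K M), IsDensePair K W := by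
  have law : ∀ l : Law K, M ⊨ l.toSentence := fun l =>
    hM.realize_of_mem _ (Set.mem_range_self l)
  let add : M → M → M := fun x y => Structure.funMap (L := ovsPair K) addFunc ![x, y]
  let neg : M → M := fun x => Structure.funMap (L := ovsPair K) negFunc ![x]
  let zero : M := Structure.funMap (L := ovsPair K) zeroFunc ![]
  let smul : K → M → M := fun c x => Structure.funMap (L := ovsPair K) (smulFunc c) ![x]
  let lt : M → M → Prop := fun x y => Structure.RelMap (L := ovsPair K) ltRel ![x, y]
  let mem : M → Prop := fun x => Structure.RelMap (L := ovsPair K) uRel ![x]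
  have addAssoc : ∀ x y z, add (add x y) z = add x (add y z) := by
    simpa [Law.toSentence, Sentence.Realize, Formula.Realize, Fin.snoc] using law .addAssoc
  have addComm : ∀ x y, add x y = add y x := by
    simpa [Law.toSentence, Sentence.Realize, Formula.Realize, Fin.snoc] using law .addComm
  have addZero : ∀ x, add x zero = x := by
    simpa [Law.toSentence, Sentence.Realize, Formula.Realize, Fin.snoc] using law .addZero
  have addNeg : ∀ x, add x (neg x) = zero := by
    simpa [Law.toSentence, Sentence.Realize, Formula.Realize, Fin.snoc] using law .addNeg
  have smulAdd : ∀ c x y, smul c (add x y) = add (smul c x) (smul c y) := fun c => by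
    simpa [Law.toSentence, Sentence.Realize, Formula.Realize, Fin.snoc] using law (.smulAdd c)
  have addSmul : ∀ c d x, smul (c + d) x = add (smul c x) (smul d x) := fun c d => by
    simpa [Law.toSentence, Sentence.Realize, Formula.Realize, Fin.snoc] using law (.addSmul c d)
  have mulSmul : ∀ c d x, smul (c * d) x = smul c (smul d x) := fun c d => by
    simpa [Law.toSentence, Sentence.Realize, Formula.Realize, Fin.snoc] using law (.mulSmul c d)
  have oneSmul : ∀ x, smul 1 x = x := by
    simpa [Law.toSentence, Sentence.Realize, Formula.Realize, Fin.snoc] using law .oneSmul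
  have ltIrrefl : ∀ x, ¬ lt x x := by
    simpa [Law.toSentence, Sentence.Realize, Formula.Realize, Fin.snoc] using law .ltIrrefl
  have ltTrans : ∀ x y z, lt x y → lt y z → lt x z := by
    simpa [Law.toSentence, Sentence.Realize, Formula.Realize, Fin.snoc] using law .ltTrans
  have ltTotal : ∀ x y, lt x y ∨ x = y ∨ lt y x := by
    simpa [Law.toSentence, Sentence.Realize, Formula.Realize, Fin.snoc] using law .ltTotal
  have addLt : ∀ x y z, lt x y → lt (add x z) (add y z) := by
    simpa [Law.toSentence, Sentence.Realize, Formula.Realize, Fin.snoc] using law .addLt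
  have smulPos : ∀ c, 0 < c → ∀ x, lt zero x → lt zero (smul c x) := fun c hc => by
    simpa [Law.toSentence, Sentence.Realize, Formula.Realize, Fin.snoc] using
      law (.smulPos c hc)
  have zeroMem : mem zero := by
    simpa [Law.toSentence, Sentence.Realize, Formula.Realize, Fin.snoc] using law .zeroMem
  have addMem : ∀ x y, mem x → mem y → mem (add x y) := by
    simpa [Law.toSentence, Sentence.Realize, Formula.Realize, Fin.snoc] using law .addMem
  have smulMem : ∀ c x, mem x → mem (smul c x) := fun c => by
    simpa [Law.toSentence, Sentence.Realize, Formula.Realize, Fin.snoc] using law (.smulMem c)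
  have dense : ∀ x y, lt x y → ∃ z, mem z ∧ lt x z ∧ lt z y := by
    simpa [Law.toSentence, Sentence.Realize, Formula.Realize, Fin.snoc] using law .dense
  have proper : ∃ x, ¬ mem x := by
    simpa [Law.toSentence, Sentence.Realize, Formula.Realize, Fin.snoc] using law .proper
  let : Add M := ⟨add⟩
  let : Neg M := ⟨neg⟩
  let : Zero M := ⟨zero⟩
  let : AddGroup M := AddGroup.ofRightAxioms addAssoc addZero addNeg
  let iGroup : AddCommGroup M := { add_comm := addComm }
  let : SMul K M := ⟨smul⟩
  let iModule : Module K M := Module.ofMinimalAxioms smulAdd addSmul mulSmul oneSmul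
  have : IsStrictTotalOrder M lt :=
    { irrefl := ltIrrefl
      trans := ltTrans
      trichotomous := fun x y h₁ h₂ => ((ltTotal x y).resolve_left h₁).resolve_right h₂ }
  let iOrder : LinearOrder M :=
    @linearOrderOfSTO M lt _ (Classical.decRel _)
  have iAddMono : IsOrderedAddMonoid M :=
    { add_le_add_left := fun x y hxy z => by
        rcases hxy.eq_or_lt with rfl | hxy
        · exact le_rfl
        · exact le_of_lt (addLt x y z hxy) }
  have iSMul : PosSMulStrictMono K M :=
    ⟨fun c hc x y hxy => by
      have := smulPos c hc (y - x) (sub_pos.2 hxy)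
      change 0 < c • (y - x) at this
      rwa [smul_sub, sub_pos] at this⟩
  let W : Submodule K M :=
    { carrier := {x | mem x}
      zero_mem' := zeroMem
      add_mem' := fun {x y} => addMem x y
      smul_mem' := smulMem }
  have vec₁ : ∀ x : Fin 1 → M, x = ![x 0] := fun x => by
    funext i; fin_cases i; rfl
  have vec₂ : ∀ x : Fin 2 → M, x = ![x 0, x 1] := fun x => by
    funext i; fin_cases i <;> rfl
  exact ⟨iGroup, iOrder, iAddMono, iModule, iSMul, W,
    { funMap_add := fun x => congrArg (Structure.funMap addFunc) (vec₂ x)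
      funMap_neg := fun x => congrArg (Structure.funMap negFunc) (vec₁ x)
      funMap_zero := fun x => congrArg (Structure.funMap zeroFunc) (Subsingleton.elim x ![])
      funMap_smul := fun c x => congrArg (Structure.funMap (smulFunc c)) (vec₁ x)
      relMap_lt := fun x => iff_of_eq (congrArg (Structure.RelMap ltRel) (vec₂ x))
      relMap_U := fun x => iff_of_eq (congrArg (Structure.RelMap uRel) (vec₁ x))
      exists_notMem := proper
      dense := dense }⟩

end DensePair

/-! ### Semantic quantifier elimination -/

section Terms

variable {K : Type u} [Field K] [LinearOrder K] [IsStrictOrderedRing K]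
  {V : Type w} [AddCommGroup V] [LinearOrder V] [IsOrderedAddMonoid V]
  [Module K V] [PosSMulStrictMono K V] [(ovsPair K).Structure V] {W : Submodule K V}

namespace IsDensePair

omit [LinearOrder K] [IsStrictOrderedRing K] [IsOrderedAddMonoid V] [PosSMulStrictMono K V] in
theorem realize_sub (h : IsDensePair K W) {α : Type} (s t : (ovsPair K).Term α) (v : α → V) :
    (tAdd s (tNeg t)).realize v = s.realize v - t.realize v := by
  simp [h.funMap_add, h.funMap_neg, sub_eq_add_neg]

omit [LinearOrder K] [IsStrictOrderedRing K] [IsOrderedAddMonoid V] [PosSMulStrictMono K V] in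
/-- Terms are affine in each variable. The variables of `t` are separated by `σ` into those equal
to the distinguished one (`none`) and the others. -/
theorem exists_realize_eq_smul_add (h : IsDensePair K W) {γ β : Type} (σ : γ → Option β)
    (t : (ovsPair K).Term γ) :
    ∃ (c : K) (s : (ovsPair K).Term β), ∀ (v : β → V) (x : V),
      t.realize (fun g => (σ g).elim x v) = c • x + s.realize v := by
  induction t with
  | var g =>
    rcases hg : σ g with _ | b
    · exact ⟨1, tZero, fun v x => by
        simp [hg, h.funMap_zero]⟩
    · exact ⟨0, Term.var b, fun v x => by simp [hg]⟩
  | func f ts ih =>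
    choose c s hs using ih
    cases f with
    | add =>
      refine ⟨c 0 + c 1, tAdd (s 0) (s 1), fun v x => ?_⟩
      refine (h.funMap_add _).trans ?_
      simp only [hs, realize_tAdd, h.funMap_add, Matrix.cons_val_zero, Matrix.cons_val_one,
        add_smul]
      abel
    | neg =>
      refine ⟨-c 0, tNeg (s 0), fun v x => ?_⟩
      refine (h.funMap_neg _).trans ?_
      simp only [hs, realize_tNeg, h.funMap_neg, Matrix.cons_val_zero, neg_smul, neg_add]
    | zero =>
      refine ⟨0, tZero, fun v x => ?_⟩
      rw [zero_smul, zero_add]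
      exact congrArg (Structure.funMap zeroFunc) (Subsingleton.elim _ _)
    | one =>
      refine ⟨0, tOne, fun v x => ?_⟩
      rw [zero_smul, zero_add]
      exact congrArg (Structure.funMap oneFunc) (Subsingleton.elim _ _)
    | smul d =>
      refine ⟨d * c 0, tSmul d (s 0), fun v x => ?_⟩
      refine (h.funMap_smul d _).trans ?_
      simp only [hs, realize_tSmul, h.funMap_smul, Matrix.cons_val_zero, mul_smul, smul_add]

/-- Likeness of the values of finitely many terms in a distinguished variable `x` and other
variables follows from likeness of the values of finitely many terms without `x` (those in `G`) and
of the differences between `x` and finitely many such values (those in `T`). -/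
theorem exists_isolating_terms (h : IsDensePair K W) {γ β : Type} (σ : γ → Option β)
    {F : Set ((ovsPair K).Term γ)} (hF : F.Finite) :
    ∃ G T : Set ((ovsPair K).Term β), G.Finite ∧ T.Finite ∧ ∀ (v v' : β → V) (x x' : V),
      (∀ t ∈ G, Alike W (t.realize v) (t.realize v')) →
      (∀ t ∈ T, Alike W (x - t.realize v) (x' - t.realize v')) →
      ∀ t ∈ F, Alike W (t.realize fun g => (σ g).elim x v)
        (t.realize fun g => (σ g).elim x' v') := by
  choose c s hs using h.exists_realize_eq_smul_add σ
  have hT : ∀ t (v : β → V),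
      (tNeg (tSmul (c t)⁻¹ (s t))).realize v = -((c t)⁻¹ • (s t).realize v) := by
    intro t v
    simp [h.funMap_neg, h.funMap_smul]
  -- if `c ≠ 0`, then `c • x + s` is `c` times the difference of `x` and `-c⁻¹ • s`
  refine ⟨s '' F, (fun t => tNeg (tSmul (c t)⁻¹ (s t))) '' F, hF.image _, hF.image _,
    fun v v' x x' hG hTx t ht => ?_⟩
  rw [hs, hs]
  by_cases hc : c t = 0
  · simpa [hc] using hG _ ⟨t, ht, rfl⟩
  · have := (hTx _ ⟨t, ht, rfl⟩).smul (c t)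
    rw [hT, hT] at this
    simpa [smul_sub, smul_smul, hc] using this

/-- Quantifier elimination in semantic form: the truth of a formula is determined by finitely
many terms, up to likeness of their values. -/
theorem exists_finite_determining_terms (h : IsDensePair K W) {α : Type} {n : ℕ}
    (φ : (ovsPair K).BoundedFormula α n) :
    ∃ F : Set ((ovsPair K).Term (α ⊕ Fin n)), F.Finite ∧
      ∀ (v v' : α → V) (xs xs' : Fin n → V),
        (∀ t ∈ F, Alike W (t.realize (Sum.elim v xs)) (t.realize (Sum.elim v' xs'))) →
        (φ.Realize v xs ↔ φ.Realize v' xs') := by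
  induction φ with
  | falsum => exact ⟨∅, Set.finite_empty, fun _ _ _ _ _ => Iff.rfl⟩
  | equal t₁ t₂ =>
    refine ⟨{tAdd t₁ (tNeg t₂)}, Set.finite_singleton _, fun v v' xs xs' hF => ?_⟩
    have := (hF _ rfl).eq_zero_iff
    rw [h.realize_sub, h.realize_sub, sub_eq_zero, sub_eq_zero] at this
    exact this
  | rel R ts =>
    cases R with
    | lt =>
      refine ⟨{tAdd (ts 0) (tNeg (ts 1))}, Set.finite_singleton _, fun v v' xs xs' hF => ?_⟩
      have := (hF _ rfl).2.1
      rw [h.realize_sub, h.realize_sub, sub_neg, sub_neg] at this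
      exact (h.relMap_lt _).trans (this.trans
        (h.relMap_lt fun i => (ts i).realize (Sum.elim v' xs')).symm)
    | U =>
      refine ⟨{ts 0}, Set.finite_singleton _, fun v v' xs xs' hF => ?_⟩
      exact (h.relMap_U _).trans ((hF _ rfl).2.2.trans
        (h.relMap_U fun i => (ts i).realize (Sum.elim v' xs')).symm)
  | imp φ ψ ihφ ihψ =>
    obtain ⟨F, hF, hφ⟩ := ihφ
    obtain ⟨G, hG, hψ⟩ := ihψ
    refine ⟨F ∪ G, hF.union hG, fun v v' xs xs' hFG => ?_⟩
    rw [BoundedFormula.realize_imp, BoundedFormula.realize_imp,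
      hφ v v' xs xs' fun t ht => hFG t (Or.inl ht), hψ v v' xs xs' fun t ht => hFG t (Or.inr ht)]
  | @all n φ ih =>
    obtain ⟨F, hF, hφ⟩ := ih
    let σ : α ⊕ Fin (n + 1) → Option (α ⊕ Fin n) :=
      Sum.elim (fun i => some (Sum.inl i))
        (Fin.lastCases none fun i => some (Sum.inr i))
    have hσ : ∀ (v : α → V) (xs : Fin n → V) (x : V),
        (fun g => (σ g).elim x (Sum.elim v xs)) = Sum.elim v (Fin.snoc xs x) := by
      intro v xs x
      funext g
      rcases g with i | i
      · rfl
      · refine Fin.lastCases ?_ (fun i => ?_) i <;> simp [σ]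
    -- the position of the quantified variable relative to the terms in `T` can be matched as soon
    -- as the differences of these terms are alike
    obtain ⟨G, T, hG, hT, hGT⟩ := h.exists_isolating_terms σ hF
    refine ⟨G ∪ Set.image2 (fun s t => tAdd s (tNeg t)) T T, hG.union (hT.image2 _ hT), ?_⟩
    suffices H : ∀ (v v' : α → V) (xs xs' : Fin n → V),
        (∀ t ∈ G ∪ Set.image2 (fun s t => tAdd s (tNeg t)) T T,
          Alike W (t.realize (Sum.elim v xs)) (t.realize (Sum.elim v' xs'))) →
        (φ.all.Realize v xs → φ.all.Realize v' xs') from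
      fun v v' xs xs' hF => ⟨H v v' xs xs' hF, H v' v xs' xs fun t ht => (hF t ht).symm⟩
    intro v v' xs xs' hF hall
    rw [BoundedFormula.realize_all] at hall ⊢
    intro x'
    obtain ⟨x, hx⟩ := exists_alike_sub h.exists_notMem h.dense hT
      (p := fun t => t.realize (Sum.elim v' xs')) (q := fun t => t.realize (Sum.elim v xs))
      (fun s hs t ht => by
        have := (hF _ (Or.inr ⟨s, hs, t, ht, rfl⟩)).symm
        rwa [h.realize_sub, h.realize_sub] at this) x'
    have := hGT (Sum.elim v xs) (Sum.elim v' xs') x x' (fun t ht => hF t (Or.inl ht))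
      (fun t ht => (hx t ht).symm)
    rw [hσ, hσ] at this
    exact (hφ v v' _ _ this).1 (hall x)

/-- For fixed parameters `b`, the truth of the formulas `φ(x; b)` depends only on the position
of `x` relative to the values at `b` of finitely many terms. -/
theorem exists_finite_position_terms (h : IsDensePair K W) {n : ℕ}
    (Δ : Finset ((ovsPair K).Formula (Fin 1 ⊕ Fin n))) :
    ∃ T : Set ((ovsPair K).Term (Fin n)), T.Finite ∧
      ∀ φ ∈ Δ, ∀ (b : Fin n → V) (x x' : Fin 1 → V),
        (∀ t ∈ T, Alike W (x 0 - t.realize b) (x' 0 - t.realize b)) →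
        (φ.Realize (Sum.elim x b) ↔ φ.Realize (Sum.elim x' b)) := by
  have single : ∀ φ : (ovsPair K).Formula (Fin 1 ⊕ Fin n),
      ∃ T : Set ((ovsPair K).Term (Fin n)), T.Finite ∧ ∀ (b : Fin n → V) (x x' : Fin 1 → V),
        (∀ t ∈ T, Alike W (x 0 - t.realize b) (x' 0 - t.realize b)) →
        (φ.Realize (Sum.elim x b) ↔ φ.Realize (Sum.elim x' b)) := by
    intro φ
    obtain ⟨F, hF, hφ⟩ := h.exists_finite_determining_terms φ
    let σ : (Fin 1 ⊕ Fin n) ⊕ Fin 0 → Option (Fin n) :=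
      Sum.elim (Sum.elim (fun _ => none) some) (fun i => i.elim0)
    have hσ : ∀ (b : Fin n → V) (x : Fin 1 → V),
        (fun g => (σ g).elim (x 0) b) = Sum.elim (Sum.elim x b) default := by
      intro b x
      funext g
      rcases g with (i | i) | i
      · simp [σ, Subsingleton.elim i 0]
      · rfl
      · exact i.elim0
    -- the terms not involving `x` take the same values on both sides
    obtain ⟨G, T, -, hT, hGT⟩ := h.exists_isolating_terms σ hF
    refine ⟨T, hT, fun b x x' hx => hφ _ _ _ _ ?_⟩
    have := hGT b b (x 0) (x' 0) (fun t _ => ⟨Iff.rfl, Iff.rfl, Iff.rfl⟩) hx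
    rwa [hσ, hσ] at this
  choose T hT hφ using single
  exact ⟨⋃ φ ∈ Δ, T φ, Δ.finite_toSet.biUnion fun φ _ => hT φ, fun φ hφΔ b x x' hx =>
    hφ φ b x x' fun t ht => hx t (Set.mem_biUnion hφΔ ht)⟩

end IsDensePair

end Terms

/-! ### Describing an element by a cut and a coset -/

section Description

variable {K : Type u} {V : Type w} [(ovsPair K).Structure V] {β γ : Type}

/-- The shape of the cut of an element: it lies below all values of terms (`none`), at the value of
`t` (`some (t, true)`), or above the value of `t` with no other value in between
(`some (t, false)`). -/
abbrev CutShape (T : Set ((ovsPair K).Term β)) : Type u := Option (T × Bool)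

/-- The shape of the coset of an element modulo the subspace: that of the value of a term
(`some t`), or one containing no value of a term (`none`). -/
abbrev CosetShape (T : Set ((ovsPair K).Term β)) : Type u := Option T

/-- The formula saying that `x` is in the position relative to `s` prescribed by the shape of its
cut, where the term in the shape is evaluated at the variables `e`. -/
noncomputable def cutFormula {T : Set ((ovsPair K).Term β)} (e : β → γ)
    (x s : (ovsPair K).Term γ) : CutShape T → (ovsPair K).Formula γ
  | none => ltRel.formula₂ x s
  | some (t, true) =>
    (ltRel.formula₂ x s).iff (ltRel.formula₂ (t.1.relabel e) s) ⊓
      (ltRel.formula₂ s x).iff (ltRel.formula₂ s (t.1.relabel e))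
  | some (t, false) =>
    (ltRel.formula₂ x s).iff (ltRel.formula₂ (t.1.relabel e) s) ⊓
      (ltRel.formula₂ s x).iff (ltRel.formula₂ (t.1.relabel e) s).not

/-- The formula saying that `x` is congruent to `s` if and only if the shape of its coset
prescribes this, where the term in the shape is evaluated at the variables `e`. -/
noncomputable def cosetFormula {T : Set ((ovsPair K).Term β)} (e : β → γ)
    (x s : (ovsPair K).Term γ) : CosetShape T → (ovsPair K).Formula γ
  | none => (uRel.formula₁ (tAdd x (tNeg s))).not
  | some t => (uRel.formula₁ (tAdd x (tNeg s))).iff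
      (uRel.formula₁ (tAdd (t.1.relabel e) (tNeg s)))

end Description

section Position

variable {K : Type u} [Field K] [LinearOrder K] [IsStrictOrderedRing K]
  {V : Type w} [AddCommGroup V] [LinearOrder V] [IsOrderedAddMonoid V]
  [Module K V] [PosSMulStrictMono K V] [(ovsPair K).Structure V] {W : Submodule K V}
  {β γ : Type} {T : Set ((ovsPair K).Term β)}

/-- The position of `x` relative to `s` is as prescribed by the shape of its cut, with the term in
the shape evaluated at `c`. -/
def InCut (c : β → V) (x s : V) : CutShape T → Prop
  | none => x < s
  | some (t, true) => (x < s ↔ t.1.realize c < s) ∧ (s < x ↔ s < t.1.realize c)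
  | some (t, false) => (x < s ↔ t.1.realize c < s) ∧ (s < x ↔ ¬ t.1.realize c < s)

/-- Whether `x` is congruent to `s` modulo `W` is as prescribed by the shape of its coset, with the
term in the shape evaluated at `c`. -/
def InCoset (W : Submodule K V) (c : β → V) (x s : V) : CosetShape T → Prop
  | none => x - s ∉ W
  | some t => x - s ∈ W ↔ t.1.realize c - s ∈ W

namespace IsDensePair

omit [LinearOrder K] [IsStrictOrderedRing K] [IsOrderedAddMonoid V] [PosSMulStrictMono K V] in
theorem realize_cutFormula (h : IsDensePair K W) (e : β → γ) (x s : (ovsPair K).Term γ)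
    (o : CutShape T) (v : γ → V) :
    (cutFormula e x s o).Realize v ↔ InCut (v ∘ e) (x.realize v) (s.realize v) o := by
  rcases o with _ | ⟨t, _ | _⟩ <;>
    simp [cutFormula, InCut, h.relMap_lt]

omit [LinearOrder K] [IsStrictOrderedRing K] [IsOrderedAddMonoid V] [PosSMulStrictMono K V] in
theorem realize_cosetFormula (h : IsDensePair K W) (e : β → γ) (x s : (ovsPair K).Term γ)
    (o : CosetShape T) (v : γ → V) :
    (cosetFormula e x s o).Realize v ↔ InCoset W (v ∘ e) (x.realize v) (s.realize v) o := by
  rcases o with _ | t <;>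
    simp [cosetFormula, InCoset, h.relMap_U, h.realize_sub]

end IsDensePair

omit [LinearOrder K] [IsStrictOrderedRing K] [PosSMulStrictMono K V] in
/-- Two elements with the same description have the same position relative to `s`. -/
theorem alike_of_inCut_of_inCoset {c₁ c₂ : β → V} {x x' s : V} {o₁ : CutShape T}
    {o₂ : CosetShape T} (h₁ : InCut c₁ x s o₁) (h₁' : InCut c₁ x' s o₁)
    (h₂ : InCoset W c₂ x s o₂) (h₂' : InCoset W c₂ x' s o₂) : Alike W (x - s) (x' - s) := by
  rw [Alike, sub_pos, sub_pos, sub_neg, sub_neg]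
  refine (and_assoc.1 ⟨?_, ?_⟩)
  · rcases o₁ with _ | ⟨t, _ | _⟩
    · exact ⟨iff_of_false h₁.not_gt h₁'.not_gt, iff_of_true h₁ h₁'⟩
    · exact ⟨h₁.2.trans h₁'.2.symm, h₁.1.trans h₁'.1.symm⟩
    · exact ⟨h₁.2.trans h₁'.2.symm, h₁.1.trans h₁'.1.symm⟩
  · rcases o₂ with _ | t
    · exact iff_of_false h₂ h₂'
    · exact h₂.trans h₂'.symm

omit [LinearOrder K] [IsStrictOrderedRing K] [IsOrderedAddMonoid V] [PosSMulStrictMono K V] in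
/-- Relative to the values of finitely many terms at the elements of `B`, every element is
described by the shapes of its cut and its coset and by one element of `B` for each of them. -/
theorem exists_isDescribed (hT : T.Finite) {B : Set (β → V)} (hB : B.Finite)
    (hne : B.Nonempty) (a : V) :
    ∃ (o : CutShape T × CosetShape T), ∃ c₁ ∈ B, ∃ c₂ ∈ B, ∀ b ∈ B, ∀ s ∈ T,
      InCut c₁ a (s.realize b) o.1 ∧ InCoset W c₂ a (s.realize b) o.2 := by
  have hcut : ∃ o : CutShape T, ∃ c ∈ B, ∀ b ∈ B, ∀ s ∈ T, InCut c a (s.realize b) o := by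
    -- the values not exceeding `a`, indexed by the pairs of a term and a parameter tuple
    let P : Set ((ovsPair K).Term β × (β → V)) := {p ∈ T ×ˢ B | p.1.realize p.2 ≤ a}
    have hP : P.Finite := (hT.prod hB).subset (Set.sep_subset _ _)
    rcases P.eq_empty_or_nonempty with hempty | hPne
    · obtain ⟨c, hc⟩ := hne
      refine ⟨none, c, hc, fun b hb s hs => lt_of_not_ge fun hle => ?_⟩
      exact hempty.le (show (s, b) ∈ P from ⟨⟨hs, hb⟩, hle⟩)
    · obtain ⟨⟨t, c⟩, ⟨⟨ht, hc⟩, hle⟩, hmax⟩ :=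
        hP.exists_maximalFor (fun p => p.1.realize p.2) P hPne
      have hmax' : ∀ b ∈ B, ∀ s ∈ T, s.realize b ≤ a → s.realize b ≤ t.realize c := by
        intro b hb s hs hsa
        rcases le_total (s.realize b) (t.realize c) with h | h
        · exact h
        · exact hmax (j := (s, b)) ⟨⟨hs, hb⟩, hsa⟩ h
      rcases hle.eq_or_lt with heq | hlt
      · exact ⟨some (⟨t, ht⟩, true), c, hc, fun b hb s hs => by
          simp only at heq
          subst heq
          exact ⟨Iff.rfl, Iff.rfl⟩⟩
      · refine ⟨some (⟨t, ht⟩, false), c, hc, fun b hb s hs => ⟨⟨fun h => hlt.trans h,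
          fun h => ?_⟩, ⟨fun h => not_lt.2 (hmax' b hb s hs h.le),
          fun h => (not_lt.1 h).trans_lt hlt⟩⟩⟩
        exact lt_of_not_ge fun hle => (hmax' b hb s hs hle).not_gt h
  have hcoset : ∃ o : CosetShape T, ∃ c ∈ B, ∀ b ∈ B, ∀ s ∈ T,
      InCoset W c a (s.realize b) o := by
    by_cases hex : ∃ c ∈ B, ∃ t ∈ T, a - t.realize c ∈ W
    · obtain ⟨c, hc, t, ht, htc⟩ := hex
      refine ⟨some ⟨t, ht⟩, c, hc, fun b hb s hs => ?_⟩
      change a - s.realize b ∈ W ↔ t.realize c - s.realize b ∈ W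
      rw [← sub_add_sub_cancel a (t.realize c) (s.realize b)]
      exact W.add_mem_iff_right htc
    · obtain ⟨c, hc⟩ := hne
      exact ⟨none, c, hc, fun b hb s hs hmem => hex ⟨b, hb, s, hs, hmem⟩⟩
  obtain ⟨o₁, c₁, hc₁, h₁⟩ := hcut
  obtain ⟨o₂, c₂, hc₂, h₂⟩ := hcoset
  exact ⟨(o₁, o₂), c₁, hc₁, c₂, hc₂, fun b hb s hs => ⟨h₁ b hb s hs, h₂ b hb s hs⟩⟩

/-- The formula saying that some `x` satisfying `φ(x; y)` has the prescribed cut and coset relative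
to the values at `y` of the terms in `T`. The terms in the shapes of the cut and the coset are
evaluated at the first and the second tuple of parameters, respectively. -/
noncomputable def definingFormula {n : ℕ} (T : Set ((ovsPair K).Term (Fin n))) [Finite T]
    (o : CutShape T × CosetShape T) (φ : (ovsPair K).Formula (Fin 1 ⊕ Fin n)) :
    (ovsPair K).Formula (Fin n ⊕ (Fin 2 × Fin n)) :=
  Formula.iExs (Fin 1)
    (φ.relabel (Sum.elim Sum.inr fun j => Sum.inl (Sum.inl j)) ⊓
      Formula.iInf fun s : T =>
        cutFormula (fun j => Sum.inl (Sum.inr (0, j))) (Term.var (Sum.inr 0))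
            (s.1.relabel fun j => Sum.inl (Sum.inl j)) o.1 ⊓
          cosetFormula (fun j => Sum.inl (Sum.inr (1, j))) (Term.var (Sum.inr 0))
            (s.1.relabel fun j => Sum.inl (Sum.inl j)) o.2)

namespace IsDensePair

omit [LinearOrder K] [IsStrictOrderedRing K] [IsOrderedAddMonoid V] [PosSMulStrictMono K V] in
theorem realize_definingFormula (h : IsDensePair K W) {n : ℕ}
    (T : Set ((ovsPair K).Term (Fin n))) [Finite T] (o : CutShape T × CosetShape T)
    (φ : (ovsPair K).Formula (Fin 1 ⊕ Fin n)) (b : Fin n → V) (c : Fin 2 × Fin n → V) :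
    (definingFormula T o φ).Realize (Sum.elim b c) ↔ ∃ x : Fin 1 → V,
      φ.Realize (Sum.elim x b) ∧ ∀ s ∈ T, InCut (fun j => c (0, j)) (x 0) (s.realize b) o.1 ∧
        InCoset W (fun j => c (1, j)) (x 0) (s.realize b) o.2 := by
  have hv : ∀ x : Fin 1 → V, Sum.elim (Sum.elim b c) x ∘
      (Sum.elim Sum.inr fun j => Sum.inl (Sum.inl j) :
        Fin 1 ⊕ Fin n → (Fin n ⊕ Fin 2 × Fin n) ⊕ Fin 1) = Sum.elim x b := by
    intro x
    funext i
    rcases i with i | i <;> rfl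
  simp only [definingFormula, Formula.realize_iExs, Formula.realize_inf, Formula.realize_relabel,
    Formula.realize_iInf, h.realize_cutFormula, h.realize_cosetFormula, hv, Term.realize_relabel,
    Subtype.forall]
  rfl

theorem hasVCProperty (h : IsDensePair K W) : HasVCProperty (ovsPair K) V 2 := by
  intro n Δ
  obtain ⟨T, hT, hΔ⟩ := h.exists_finite_position_terms Δ
  have := hT.to_subtype
  obtain ⟨r, ⟨e⟩⟩ := Finite.exists_equiv_fin (CutShape T × CosetShape T)
  refine ⟨r, fun i φ => definingFormula T (e.symm i) φ, fun B hB hne p hp => ?_⟩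
  obtain ⟨a, ha⟩ := hp.exists_realize_iff hB
  obtain ⟨o, c₁, hc₁, c₂, hc₂, ho⟩ := exists_isDescribed (W := W) hT hB hne (a 0)
  refine ⟨e o, ![c₁, c₂], fun k => ?_, fun φ b hb => ?_⟩
  · fin_cases k
    exacts [hc₁, hc₂]
  · rw [ha φ φ.2 b hb, h.realize_definingFormula, e.symm_apply_apply]
    refine ⟨fun hφ => ⟨a, hφ, ho b hb⟩, ?_⟩
    rintro ⟨x, hφ, hx⟩
    refine (hΔ φ φ.2 b x a fun s hs => ?_).1 hφ
    exact alike_of_inCut_of_inCoset (hx s hs).1 (ho b hb s hs).1 (hx s hs).2 (ho b hb s hs).2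

end IsDensePair

end Position

end ovsPair

end FirstOrder.Language

theorem mainTheorem2 (K : Type u) [Field K] [LinearOrder K] [IsStrictOrderedRing K]
    (M : Type w) [(Language.ovsPair K).Structure M]
    (hM : M ⊨ Language.ovsPair.densePairs K) :
    Language.HasVCProperty (Language.ovsPair K) M 2 := by
  obtain ⟨_, _, _, _, _, W, hW⟩ := Language.ovsPair.exists_isDensePair hM
  exact hW.hasVCProperty
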